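/- Let $(\Omega,\Sigma,\mu)$ be a complete $\sigma$-finite measure space and let $L_0(\Omega)$ be the space of (classes modulo equality a.e. of) measurable real- or complex-valued functions on $\Omega$ that are integrable over every measurable set of finite measure. A Köthe space over $(\Omega,\Sigma,\mu)$ is a Banach space $X$ that is a linear subspace of $L_0(\Omega)$ such that (i) if $f$ is measurable, $g\in X$ and $|f|\le|g|$ a.e., then $f\in X$ and $\|f\|_X\le\|g\|_X$, and (ii) $\chi_\sigma\in X$ for every $\sigma\in\Sigma$ with $\mu(\sigma)<\infty$. It has the Fatou property if its closed unit ball is closed in $L_0(\Omega)$ for the topology of local convergence in measure (convergence in measure on every set of finite measure). For $A\in\Sigma$ put $X|_A=\{f\chi_A: f\in X\}$, with the norm of $X$. For two Köthe spaces $X,Y$ over $(\Omega,\Sigma,\mu)$ with the same scalar field let $M(X,Y)=\{\lambda\in L_0(\Omega): \lambda f\in Y \text{ for all } f\in X\}$, and for $\lambda\in M(X,Y)$ let $M_\lambda$ denote the (automatically bounded) multiplication operator $f\mapsto\lambda f$. The essential norm of a bounded operator $T\colon E\to F$ between Banach spaces is $\|T\colon E\to F\|_{ess}=\inf\{\|T-K\|: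 K\colon E\to F \text{ compact}\}$. **Theorem.** Let $X$ and $Y$ be Köthe spaces with the Fatou property over the same complete $\sigma$-finite measure space $(\Omega,\Sigma,\mu)$, and suppose that at least one of $X$ and $Y$ is reflexive. Let $\Omega=\Omega_c\cup\Omega_a$ be the decomposition of $\Omega$ into its non-atomic part $\Omega_c$ and its purely atomic part $\Omega_a$ (disjoint measurable sets such that $\Omega_c$ contains no atom and every measurable subset of $\Omega_a$ of positive measure contains an atom). Then for every $\lambda\in M(X,Y)$, $$m\le\|M_\lambda\colon X\to Y\|_{ess}\le 2\,m,\qquad\text{where } m=\max\left\{\|M_\lambda\colon X|_{\Omega_c}\to Y|_{\Omega_c}\|_{ess},\ \|M_\lambda\colon X|_{\Omega_a}\to Y|_{\Omega_a}\|_{ess}\right\}.$$ -/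

import Mathlib

open MeasureTheory Filter Topology

/-- `L₀(Ω, Σ, μ)`: classes, modulo equality almost everywhere, of scalar functions that are
integrable over every measurable set of finite measure. -/
def LZero {Ω : Type*} [MeasurableSpace Ω] (𝕜 : Type*) [RCLike 𝕜] (μ : Measure Ω) :
    Submodule 𝕜 (Ω →ₘ[μ] 𝕜) where
  carrier := {f | ∀ s, MeasurableSet s → μ s < ⊤ → IntegrableOn f s μ}
  zero_mem' := fun s _ _ =>
    (integrable_zero Ω 𝕜 (μ.restrict s)).congr (ae_restrict_of_ae AEEqFun.coeFn_zero.symm)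
  add_mem' := fun {f g} hf hg s hs hμ =>
    ((hf s hs hμ).add (hg s hs hμ)).congr (ae_restrict_of_ae (AEEqFun.coeFn_add f g).symm)
  smul_mem' := fun c f hf s hs hμ =>
    ((hf s hs hμ).smul c).congr (ae_restrict_of_ae (AEEqFun.coeFn_smul c f).symm)

/-- The class of the characteristic function of a measurable set. -/
noncomputable def charFn {Ω : Type*} [MeasurableSpace Ω] (𝕜 : Type*) [RCLike 𝕜] (μ : Measure Ω)
    {s : Set Ω} (hs : MeasurableSet s) : Ω →ₘ[μ] 𝕜 :=
  AEEqFun.mk (s.indicator fun _ => (1 : 𝕜))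
    ((stronglyMeasurable_const.indicator hs).aestronglyMeasurable)

/-- A Köthe space (Banach ideal space, Banach function space) over `(Ω, Σ, μ)`. -/
structure KotheSpace {Ω : Type*} [MeasurableSpace Ω] (𝕜 : Type*) [RCLike 𝕜] (μ : Measure Ω) where
  /-- the linear subspace of `L₀` -/
  carrier : Submodule 𝕜 (Ω →ₘ[μ] 𝕜)
  le_LZero : carrier ≤ LZero 𝕜 μ
  /-- the norm -/
  nrm : carrier → ℝ
  nrm_nonneg : ∀ f, 0 ≤ nrm f
  nrm_add_le : ∀ f g, nrm (f + g) ≤ nrm f + nrm g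
  nrm_smul : ∀ (c : 𝕜) f, nrm (c • f) = ‖c‖ * nrm f
  nrm_eq_zero : ∀ f, nrm f = 0 → f = 0
  /-- every Cauchy sequence converges -/
  complete : ∀ u : ℕ → carrier,
    (∀ ε > 0, ∃ N, ∀ m ≥ N, ∀ n ≥ N, nrm (u m - u n) < ε) →
      ∃ f, Tendsto (fun n => nrm (u n - f)) atTop (𝓝 0)
  /-- the ideal property -/
  ideal : ∀ (f : Ω →ₘ[μ] 𝕜) (g : carrier), (∀ᵐ ω ∂μ, ‖f ω‖ ≤ ‖(g : Ω →ₘ[μ] 𝕜) ω‖) →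
    ∃ hf : f ∈ carrier, nrm ⟨f, hf⟩ ≤ nrm g
  charFn_mem : ∀ (s : Set Ω) (hs : MeasurableSet s), μ s < ⊤ → charFn 𝕜 μ hs ∈ carrier

namespace KotheSpace

section

variable {Ω : Type*} [MeasurableSpace Ω] {𝕜 : Type*} [RCLike 𝕜] {μ : Measure Ω}

/-- The Köthe space as a type (its elements are classes of functions). -/
def Elem (X : KotheSpace 𝕜 μ) : Type _ := X.carrier

instance (X : KotheSpace 𝕜 μ) : AddCommGroup X.Elem := inferInstanceAs (AddCommGroup X.carrier)

instance (X : KotheSpace 𝕜 μ) : Module 𝕜 X.Elem := inferInstanceAs (Module 𝕜 X.carrier)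

/-- The class of functions underlying an element of a Köthe space, as a linear map. -/
def toFn (X : KotheSpace 𝕜 μ) : X.Elem →ₗ[𝕜] (Ω →ₘ[μ] 𝕜) := X.carrier.subtype

noncomputable instance (X : KotheSpace 𝕜 μ) : Norm X.Elem := ⟨X.nrm⟩

theorem normedSpaceCore (X : KotheSpace 𝕜 μ) : NormedSpace.Core 𝕜 X.Elem where
  norm_nonneg := X.nrm_nonneg
  norm_smul := X.nrm_smul
  norm_triangle := X.nrm_add_le
  norm_eq_zero_iff f := by
    refine ⟨X.nrm_eq_zero f, ?_⟩
    rintro rfl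
    have h := X.nrm_smul 0 0
    rw [zero_smul, norm_zero, zero_mul] at h
    exact h

noncomputable instance (X : KotheSpace 𝕜 μ) : NormedAddCommGroup X.Elem :=
  NormedAddCommGroup.ofCore X.normedSpaceCore

noncomputable instance (X : KotheSpace 𝕜 μ) : NormedSpace 𝕜 X.Elem :=
  NormedSpace.ofCore X.normedSpaceCore

instance (X : KotheSpace 𝕜 μ) : CompleteSpace X.Elem := by
  refine Metric.complete_of_cauchySeq_tendsto fun u hu => ?_
  obtain ⟨f, hf⟩ := X.complete u fun ε hε => by
    obtain ⟨N, hN⟩ := Metric.cauchySeq_iff.1 hu ε hε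
    refine ⟨N, fun m hm n hn => ?_⟩
    have h := hN m hm n hn
    rw [dist_eq_norm] at h
    exact h
  exact ⟨f, tendsto_iff_norm_sub_tendsto_zero.2 hf⟩

theorem toFn_injective (X : KotheSpace 𝕜 μ) : Function.Injective X.toFn :=
  Subtype.val_injective

theorem exists_of_le (X : KotheSpace 𝕜 μ) (f : Ω →ₘ[μ] 𝕜) (g : X.Elem)
    (h : ∀ᵐ ω ∂μ, ‖f ω‖ ≤ ‖X.toFn g ω‖) : ∃ f' : X.Elem, X.toFn f' = f ∧ ‖f'‖ ≤ ‖g‖ := by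
  obtain ⟨hf, hn⟩ := X.ideal f g h
  exact ⟨⟨f, hf⟩, rfl, hn⟩

theorem norm_mono (X : KotheSpace 𝕜 μ) (f g : X.Elem)
    (h : ∀ᵐ ω ∂μ, ‖X.toFn f ω‖ ≤ ‖X.toFn g ω‖) : ‖f‖ ≤ ‖g‖ := by
  obtain ⟨f', hf, hn⟩ := X.exists_of_le _ g h
  rwa [X.toFn_injective hf] at hn

/-- The Fatou property: the closed unit ball of `X` is closed in `L₀` with respect to the topology
of local convergence in measure, that is, convergence in measure on every set of finite measure.
This topology is metrizable (as `μ` is `σ`-finite), so that sequences suffice. -/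
def FatouProperty (X : KotheSpace 𝕜 μ) : Prop :=
  ∀ (u : ℕ → X.Elem) (f : Ω →ₘ[μ] 𝕜), f ∈ LZero 𝕜 μ → (∀ n, ‖u n‖ ≤ 1) →
    (∀ s, MeasurableSet s → μ s < ⊤ →
      TendstoInMeasure (μ.restrict s) (fun n => (X.toFn (u n) : Ω → 𝕜)) atTop f) →
    ∃ g : X.Elem, X.toFn g = f ∧ ‖g‖ ≤ 1

/-- The space `M(X, Y)` of pointwise multipliers. -/
def multipliers (X Y : KotheSpace 𝕜 μ) : Set (Ω →ₘ[μ] 𝕜) :=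
  {l | l ∈ LZero 𝕜 μ ∧ ∀ f : X.Elem, l * X.toFn f ∈ Y.carrier}

/-- The multiplication operator `f ↦ l f`, as a linear map. -/
def mulLinearMap (X Y : KotheSpace 𝕜 μ) (l : Ω →ₘ[μ] 𝕜) (hl : l ∈ multipliers X Y) :
    X.Elem →ₗ[𝕜] Y.Elem where
  toFun f := ⟨l * X.toFn f, hl.2 f⟩
  map_add' f g := by
    refine Y.toFn_injective ?_
    change l * X.toFn (f + g) = l * X.toFn f + l * X.toFn g
    rw [map_add]
    refine AEEqFun.ext ?_
    filter_upwards [AEEqFun.coeFn_mul l (X.toFn f + X.toFn g), AEEqFun.coeFn_mul l (X.toFn f),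
      AEEqFun.coeFn_mul l (X.toFn g), AEEqFun.coeFn_add (X.toFn f) (X.toFn g),
      AEEqFun.coeFn_add (l * X.toFn f) (l * X.toFn g)] with ω h1 h2 h3 h4 h5
    simp only [h1, h2, h3, h4, h5, Pi.mul_apply, Pi.add_apply, mul_add]
  map_smul' c f := by
    refine Y.toFn_injective ?_
    change l * X.toFn (c • f) = c • (l * X.toFn f)
    rw [map_smul]
    refine AEEqFun.ext ?_
    filter_upwards [AEEqFun.coeFn_mul l (c • X.toFn f), AEEqFun.coeFn_mul l (X.toFn f),
      AEEqFun.coeFn_smul c (X.toFn f), AEEqFun.coeFn_smul c (l * X.toFn f)] with ω h1 h2 h3 h4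
    simp only [h1, h2, h3, h4, Pi.mul_apply, Pi.smul_apply, smul_eq_mul, mul_left_comm]

theorem toFn_mulLinearMap (X Y : KotheSpace 𝕜 μ) (l : Ω →ₘ[μ] 𝕜) (hl : l ∈ multipliers X Y)
    (f : X.Elem) : Y.toFn (mulLinearMap X Y l hl f) = l * X.toFn f := rfl

/-- The pointwise absolute value of a class of functions. -/
noncomputable def absFn (f : Ω →ₘ[μ] 𝕜) : Ω →ₘ[μ] 𝕜 :=
  AEEqFun.comp (fun z : 𝕜 => ((‖z‖ : ℝ) : 𝕜)) (RCLike.continuous_ofReal.comp continuous_norm) f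

theorem coeFn_absFn (f : Ω →ₘ[μ] 𝕜) : ∀ᵐ ω ∂μ, absFn f ω = ((‖f ω‖ : ℝ) : 𝕜) :=
  AEEqFun.coeFn_comp _ _ f

theorem exists_dominating (X : KotheSpace 𝕜 μ) (h : ℕ → X.Elem)
    (hs : Summable fun n => ‖h n‖) :
    ∃ g : X.Elem, ∀ n, ∀ᵐ ω ∂μ, ‖X.toFn (h n) ω‖ ≤ ‖X.toFn g ω‖ := by
  have habs : ∀ n, ∃ a : X.Elem, X.toFn a = absFn (X.toFn (h n)) ∧ ‖a‖ ≤ ‖h n‖ := fun n => by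
    refine X.exists_of_le _ _ ?_
    filter_upwards [coeFn_absFn (X.toFn (h n))] with ω hω
    simp [hω]
  choose a ha han using habs
  have hsa : Summable a := Summable.of_norm_bounded hs han
  have hsum : ∀ m, ∀ᵐ ω ∂μ, X.toFn (∑ i ∈ Finset.range m, a i) ω
      = ((∑ i ∈ Finset.range m, ‖X.toFn (h i) ω‖ : ℝ) : 𝕜) := by
    intro m
    induction m with
    | zero =>
      simp only [Finset.range_zero, Finset.sum_empty, map_zero]
      exact AEEqFun.coeFn_zero
    | succ m ih =>
      rw [Finset.sum_range_succ, map_add, ha]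
      filter_upwards [ih, AEEqFun.coeFn_add (X.toFn (∑ i ∈ Finset.range m, a i))
        (absFn (X.toFn (h m))), coeFn_absFn (X.toFn (h m))] with ω h1 h2 h3
      rw [h2, Pi.add_apply, h1, h3, Finset.sum_range_succ]
      push_cast
      rfl
  have ht := hsa.hasSum.tendsto_sum_nat
  set g := ∑' i, a i with hg
  refine ⟨g, fun n => ?_⟩
  let φ : 𝕜 → 𝕜 → 𝕜 := fun z w => ((max (‖z‖ - ‖w‖) 0 : ℝ) : 𝕜)
  have hφ : Continuous (Function.uncurry φ) := by
    refine RCLike.continuous_ofReal.comp ?_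
    fun_prop
  let w := AEEqFun.comp₂ φ hφ (X.toFn (h n)) (X.toFn g)
  have hw : ∀ᵐ ω ∂μ, w ω = φ (X.toFn (h n) ω) (X.toFn g ω) := AEEqFun.coeFn_comp₂ _ _ _ _
  have hle : ∀ m > n, ∀ᵐ ω ∂μ, ‖w ω‖ ≤ ‖X.toFn ((∑ i ∈ Finset.range m, a i) - g) ω‖ := by
    intro m hm
    rw [map_sub]
    filter_upwards [hw, hsum m,
      AEEqFun.coeFn_sub (X.toFn (∑ i ∈ Finset.range m, a i)) (X.toFn g)] with ω h1 h2 h3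
    rw [h1, h3, Pi.sub_apply, RCLike.norm_ofReal, abs_of_nonneg (le_max_right _ _)]
    refine max_le ?_ (norm_nonneg _)
    have h4 : ‖X.toFn (h n) ω‖ ≤ ‖X.toFn (∑ i ∈ Finset.range m, a i) ω‖ := by
      rw [h2, RCLike.norm_ofReal]
      refine le_trans ?_ (le_abs_self _)
      exact Finset.single_le_sum (f := fun i => ‖X.toFn (h i) ω‖)
        (fun i _ => norm_nonneg _) (Finset.mem_range.2 hm)
    exact (sub_le_sub_right h4 _).trans (norm_sub_norm_le _ _)
  obtain ⟨w', hw', -⟩ := X.exists_of_le w _ (hle (n + 1) (Nat.lt_succ_self n))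
  have hw0 : ‖w'‖ ≤ 0 := by
    refine ge_of_tendsto (tendsto_iff_norm_sub_tendsto_zero.1 ht) ?_
    filter_upwards [eventually_gt_atTop n] with m hm
    refine X.norm_mono _ _ ?_
    rw [hw']
    exact hle m hm
  have hw1 : w' = 0 := norm_le_zero_iff.1 hw0
  have hw2 : w = 0 := by rw [← hw', hw1, map_zero]
  have hz : ∀ᵐ ω ∂μ, (0 : Ω →ₘ[μ] 𝕜) ω = 0 := AEEqFun.coeFn_zero
  rw [hw2] at hw
  filter_upwards [hw, hz] with ω h1 h2
  rw [h2] at h1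
  have h3 : (max (‖X.toFn (h n) ω‖ - ‖X.toFn g ω‖) 0 : ℝ) = 0 := by
    have h5 : φ (X.toFn (h n) ω) (X.toFn g ω) = ((0 : ℝ) : 𝕜) := by
      rw [RCLike.ofReal_zero]
      exact h1.symm
    exact RCLike.ofReal_injective h5
  have h4 := le_max_left (‖X.toFn (h n) ω‖ - ‖X.toFn g ω‖) 0
  linarith

/-- Multiplication operators between Köthe spaces are automatically bounded. -/
theorem exists_mulLinearMap_bound (X Y : KotheSpace 𝕜 μ) (l : Ω →ₘ[μ] 𝕜)
    (hl : l ∈ multipliers X Y) : ∃ C : ℝ, ∀ f, ‖mulLinearMap X Y l hl f‖ ≤ C * ‖f‖ := by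
  by_contra! hcon
  set T := mulLinearMap X Y l hl with hT
  choose f hf using fun n : ℕ => hcon (4 ^ n)
  have hpos : ∀ n, 0 < ‖f n‖ := fun n => by
    refine norm_pos_iff.2 fun h0 => ?_
    have := hf n
    simp [h0] at this
  let c : ℕ → ℝ := fun n => (1 / 2) ^ n / ‖f n‖
  have hc : ∀ n, 0 < c n := fun n => div_pos (by positivity) (hpos n)
  let h : ℕ → X.Elem := fun n => ((c n : ℝ) : 𝕜) • f n
  have hnorm : ∀ n, ‖h n‖ = (1 / 2) ^ n := fun n => by
    simp only [h, norm_smul, RCLike.norm_ofReal, abs_of_pos (hc n), c]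
    exact div_mul_cancel₀ _ (hpos n).ne'
  have hTn : ∀ n, (2 : ℝ) ^ n < ‖T (h n)‖ := fun n => by
    have h1 := mul_lt_mul_of_pos_left (hf n) (hc n)
    have h2 : c n * (4 ^ n * ‖f n‖) = 2 ^ n := by
      have h3 : c n * ‖f n‖ = (1 / 2) ^ n := div_mul_cancel₀ _ (hpos n).ne'
      calc c n * (4 ^ n * ‖f n‖) = (c n * ‖f n‖) * 4 ^ n := by ring
        _ = 2 ^ n := by rw [h3, ← mul_pow]; norm_num
    have h4 : ‖T (h n)‖ = c n * ‖T (f n)‖ := by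
      simp only [h, map_smul, norm_smul, RCLike.norm_ofReal, abs_of_pos (hc n)]
    rw [h4, ← h2]
    exact h1
  obtain ⟨g, hg⟩ := X.exists_dominating h (by
    simp only [hnorm]
    exact summable_geometric_of_lt_one (by norm_num) (by norm_num))
  obtain ⟨n, hn⟩ := pow_unbounded_of_one_lt ‖T g‖ (one_lt_two : (1 : ℝ) < 2)
  refine absurd (hn.trans (hTn n)) (not_lt.2 ?_)
  refine Y.norm_mono _ _ ?_
  rw [hT, toFn_mulLinearMap, toFn_mulLinearMap]
  filter_upwards [hg n, AEEqFun.coeFn_mul l (X.toFn (h n)), AEEqFun.coeFn_mul l (X.toFn g)]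
    with ω h1 h2 h3
  rw [h2, h3, Pi.mul_apply, Pi.mul_apply, norm_mul, norm_mul]
  exact mul_le_mul_of_nonneg_left h1 (norm_nonneg _)

/-- The multiplication operator `M_l : X → Y`, `f ↦ l f`, with symbol `l ∈ M(X, Y)`. -/
noncomputable def mulOp (X Y : KotheSpace 𝕜 μ) (l : Ω →ₘ[μ] 𝕜) (hl : l ∈ multipliers X Y) :
    X.Elem →L[𝕜] Y.Elem :=
  (mulLinearMap X Y l hl).mkContinuousOfExistsBound (exists_mulLinearMap_bound X Y l hl)

/-- The restriction `X|_A = {f χ_A : f ∈ X}`: the elements of `X` that vanish almost everywhere off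
`A`, with the norm of `X`. -/
def restrict (X : KotheSpace 𝕜 μ) (A : Set Ω) : Submodule 𝕜 X.Elem where
  carrier := {f | ∀ᵐ ω ∂μ, ω ∉ A → X.toFn f ω = 0}
  zero_mem' := by
    have hz : ∀ᵐ ω ∂μ, (0 : Ω →ₘ[μ] 𝕜) ω = 0 := AEEqFun.coeFn_zero
    simp only [Set.mem_ofPred_eq, map_zero]
    filter_upwards [hz] with ω h _ using h
  add_mem' := fun {f g} hf hg => by
    simp only [Set.mem_ofPred_eq, map_add] at hf hg ⊢
    filter_upwards [hf, hg, AEEqFun.coeFn_add (X.toFn f) (X.toFn g)] with ω h1 h2 h3 hω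
    rw [h3, Pi.add_apply, h1 hω, h2 hω, add_zero]
  smul_mem' := fun c f hf => by
    simp only [Set.mem_ofPred_eq, map_smul] at hf ⊢
    filter_upwards [hf, AEEqFun.coeFn_smul c (X.toFn f)] with ω h1 h2 hω
    rw [h2, Pi.smul_apply, h1 hω, smul_zero]

theorem mulOp_mem_restrict (X Y : KotheSpace 𝕜 μ) (l : Ω →ₘ[μ] 𝕜) (hl : l ∈ multipliers X Y)
    (A : Set Ω) (f : X.restrict A) : mulOp X Y l hl f ∈ Y.restrict A := by
  have hf : ∀ᵐ ω ∂μ, ω ∉ A → X.toFn (f : X.Elem) ω = 0 := f.2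
  change ∀ᵐ ω ∂μ, ω ∉ A → (l * X.toFn (f : X.Elem)) ω = 0
  filter_upwards [hf, AEEqFun.coeFn_mul l (X.toFn (f : X.Elem))] with ω h1 h2 hω
  rw [h2, Pi.mul_apply, h1 hω, mul_zero]

/-- The multiplication operator `M_l : X|_A → Y|_A`. -/
noncomputable def mulOpRestrict (X Y : KotheSpace 𝕜 μ) (l : Ω →ₘ[μ] 𝕜)
    (hl : l ∈ multipliers X Y) (A : Set Ω) : X.restrict A →L[𝕜] Y.restrict A :=
  ((mulOp X Y l hl).comp (X.restrict A).subtypeL).codRestrict (Y.restrict A)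
    (mulOp_mem_restrict X Y l hl A)

end

end KotheSpace

/-- The essential norm `inf {‖T - K‖ : K compact}`. -/
noncomputable def essNorm {𝕜 E F : Type*} [RCLike 𝕜] [NormedAddCommGroup E] [NormedSpace 𝕜 E]
    [NormedAddCommGroup F] [NormedSpace 𝕜 F] (T : E →L[𝕜] F) : ℝ :=
  ⨅ K : {K : E →L[𝕜] F // IsCompactOperator K}, ‖T - K‖

/-- Reflexivity: the canonical embedding into the bidual is onto. -/
def IsReflexiveSpace (𝕜 E : Type*) [RCLike 𝕜] [NormedAddCommGroup E] [NormedSpace 𝕜 E] : Prop :=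
  Function.Surjective (NormedSpace.inclusionInDoubleDual 𝕜 E)

/-- `A` is an atom of `μ`. -/
def IsMeasureAtom {Ω : Type*} [MeasurableSpace Ω] (μ : Measure Ω) (A : Set Ω) : Prop :=
  MeasurableSet A ∧ 0 < μ A ∧ ∀ B ⊆ A, MeasurableSet B → μ B = 0 ∨ μ (A \ B) = 0

/-- `Ωc` is the non-atomic part and `Ωa` the purely atomic part of the measure space: they are
measurable and complementary, `Ωc` contains no atom, and every measurable subset of `Ωa` of positive
measure contains an atom. -/
structure IsAtomicDecomposition {Ω : Type*} [MeasurableSpace Ω] (μ : Measure Ω)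
    (Ωc Ωa : Set Ω) : Prop where
  measurableSet_c : MeasurableSet Ωc
  measurableSet_a : MeasurableSet Ωa
  isCompl : IsCompl Ωc Ωa
  nonatomic : ∀ A ⊆ Ωc, ¬ IsMeasureAtom μ A
  purelyAtomic : ∀ B ⊆ Ωa, MeasurableSet B → 0 < μ B → ∃ A ⊆ B, IsMeasureAtom μ A

/-! ### Essential norms under composition and addition -/

section EssNorm

variable {𝕜 E F E' F' : Type*} [RCLike 𝕜] [NormedAddCommGroup E] [NormedSpace 𝕜 E]
  [NormedAddCommGroup F] [NormedSpace 𝕜 F] [NormedAddCommGroup E'] [NormedSpace 𝕜 E']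
  [NormedAddCommGroup F'] [NormedSpace 𝕜 F']

/-! Multiplication by `l` preserves supports, so with respect to the splitting of `X` and `Y` into
their parts on `Ωc` and `Ωa` the operator is block diagonal. Let P_A denote the cut-off f ↦ f χ_A
and J_A the inclusion of the restricted space; both have norm at most 1, P_A by the ideal property.

Lower bound: the block on A is the compression P_A M_l J_A. Compact operators form an ideal, so
composing with contractions cannot raise the essential norm (`essNorm_comp_comp_le`).

Upper bound: M_l is the sum over the two parts of J_A (block on A) P_A (`mulOp_eq_add`). The
essential norm is subadditive (`essNorm_add_le`), so it is at most the sum of the essential norms of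
the two blocks. The factor 2 comes from a + b ≤ 2 max(a, b). -/

theorem essNorm_le_norm_sub (T K : E →L[𝕜] F) (hK : IsCompactOperator K) :
    essNorm T ≤ ‖T - K‖ :=
  ciInf_le (f := fun K : {K : E →L[𝕜] F // IsCompactOperator K} => ‖T - K‖)
    ⟨0, by rintro _ ⟨K, rfl⟩; exact norm_nonneg _⟩ ⟨K, hK⟩

theorem le_essNorm {T : E →L[𝕜] F} {a : ℝ}
    (h : ∀ K : E →L[𝕜] F, IsCompactOperator K → a ≤ ‖T - K‖) : a ≤ essNorm T :=
  -- A real infimum over an empty family would be the default value 0; the zero operator rules this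
  -- out.
  haveI : Nonempty {K : E →L[𝕜] F // IsCompactOperator K} := ⟨⟨0, isCompactOperator_zero⟩⟩
  le_ciInf fun K => h K.1 K.2

/-- Composing with contractions on both sides does not increase the essential norm. -/
theorem essNorm_comp_comp_le (T : E →L[𝕜] F) (A : E' →L[𝕜] E) (B : F →L[𝕜] F')
    (hA : ‖A‖ ≤ 1) (hB : ‖B‖ ≤ 1) : essNorm (B.comp (T.comp A)) ≤ essNorm T := by
  refine le_essNorm fun K hK => ?_
  have hc : IsCompactOperator (B.comp (K.comp A)) := (hK.comp_clm A).clm_comp B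
  refine (essNorm_le_norm_sub _ _ hc).trans ?_
  rw [← ContinuousLinearMap.comp_sub, ← ContinuousLinearMap.sub_comp]
  calc ‖B.comp ((T - K).comp A)‖ ≤ ‖B‖ * (‖T - K‖ * ‖A‖) :=
        (B.opNorm_comp_le _).trans
          (mul_le_mul_of_nonneg_left ((T - K).opNorm_comp_le A) (norm_nonneg _))
    _ ≤ 1 * (‖T - K‖ * 1) := by gcongr
    _ = ‖T - K‖ := by ring

theorem essNorm_add_le (S T : E →L[𝕜] F) : essNorm (S + T) ≤ essNorm S + essNorm T := by
  -- Subtraction isolates one infimum at a time on the right, so `le_essNorm` applies to each in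
  -- turn and no ε-approximate minimisers are needed.
  rw [← sub_le_iff_le_add]
  refine le_essNorm fun K hK => ?_
  rw [sub_le_comm]
  refine le_essNorm fun L hL => ?_
  rw [sub_le_iff_le_add']
  refine (essNorm_le_norm_sub _ (K + L) (hK.add hL)).trans ?_
  rw [add_sub_add_comm]
  exact norm_add_le _ _

end EssNorm

/-! ### Band projections -/

namespace KotheSpace

section Projection

variable {Ω : Type*} [MeasurableSpace Ω] {𝕜 : Type*} [RCLike 𝕜] {μ : Measure Ω}

theorem coeFn_charFn_mul {A : Set Ω} (hA : MeasurableSet A) (f : Ω →ₘ[μ] 𝕜) :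
    ∀ᵐ ω ∂μ, (charFn 𝕜 μ hA * f) ω = A.indicator f ω := by
  have h : ∀ᵐ ω ∂μ, charFn 𝕜 μ hA ω = A.indicator (fun _ => (1 : 𝕜)) ω :=
    AEEqFun.coeFn_mk _ _
  filter_upwards [h, AEEqFun.coeFn_mul (charFn 𝕜 μ hA) f] with ω h1 h2
  rw [h2, Pi.mul_apply, h1]
  by_cases hω : ω ∈ A <;> simp [hω]

theorem exists_charFn_mul (X : KotheSpace 𝕜 μ) {A : Set Ω} (hA : MeasurableSet A) (f : X.Elem) :
    ∃ g : X.Elem, X.toFn g = charFn 𝕜 μ hA * X.toFn f ∧ ‖g‖ ≤ ‖f‖ := by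
  refine X.exists_of_le _ f ?_
  filter_upwards [coeFn_charFn_mul hA (X.toFn f)] with ω h
  rw [h]
  exact norm_indicator_le_norm_self _ _

/-- This makes the cut-off by A a multiplication operator, from which the band projection inherits
its linearity. -/
theorem charFn_mem_multipliers (X : KotheSpace 𝕜 μ) {A : Set Ω} (hA : MeasurableSet A) :
    charFn 𝕜 μ hA ∈ multipliers X X := by
  refine ⟨fun s hs hμ => ?_, fun f => ?_⟩
  · have h : IntegrableOn (A.indicator fun _ => (1 : 𝕜)) s μ :=
      (integrableOn_const hμ.ne).indicator hA
    exact h.congr (ae_restrict_of_ae (AEEqFun.coeFn_mk _ _).symm)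
  · obtain ⟨g, hg, -⟩ := X.exists_charFn_mul hA f
    exact hg ▸ g.2

/-- The band projection `f ↦ f χ_A` of `X` onto `X|_A`. -/
noncomputable def bandProj (X : KotheSpace 𝕜 μ) {A : Set Ω} (hA : MeasurableSet A) :
    X.Elem →L[𝕜] X.restrict A :=
  ((mulLinearMap X X _ (X.charFn_mem_multipliers hA)).codRestrict (X.restrict A) fun f => by
    change ∀ᵐ ω ∂μ, ω ∉ A → (charFn 𝕜 μ hA * X.toFn f) ω = 0
    filter_upwards [coeFn_charFn_mul hA (X.toFn f)] with ω h hω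
    rw [h, Set.indicator_of_notMem hω]).mkContinuous 1 fun f => by
      obtain ⟨g, hg, hn⟩ := X.exists_charFn_mul hA f
      rw [one_mul]
      have h : mulLinearMap X X _ (X.charFn_mem_multipliers hA) f = g :=
        X.toFn_injective ((toFn_mulLinearMap ..).trans hg.symm)
      exact (congrArg norm h).trans_le hn

theorem toFn_bandProj (X : KotheSpace 𝕜 μ) {A : Set Ω} (hA : MeasurableSet A) (f : X.Elem) :
    X.toFn (X.bandProj hA f : X.Elem) = charFn 𝕜 μ hA * X.toFn f := rfl

theorem norm_bandProj_le (X : KotheSpace 𝕜 μ) {A : Set Ω} (hA : MeasurableSet A) :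
    ‖X.bandProj hA‖ ≤ 1 :=
  LinearMap.mkContinuous_norm_le _ zero_le_one _

/-- A function vanishing a.e. off A is unchanged by the cut-off, so P_A is a left inverse of J_A. -/
theorem bandProj_restrict (X : KotheSpace 𝕜 μ) {A : Set Ω} (hA : MeasurableSet A)
    (f : X.restrict A) : X.bandProj hA f = f := by
  refine Subtype.ext (X.toFn_injective (AEEqFun.ext ?_))
  have hf : ∀ᵐ ω ∂μ, ω ∉ A → X.toFn (f : X.Elem) ω = 0 := f.2
  rw [toFn_bandProj]
  filter_upwards [coeFn_charFn_mul hA (X.toFn (f : X.Elem)), hf] with ω h1 h2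
  rw [h1]
  by_cases hω : ω ∈ A
  · rw [Set.indicator_of_mem hω]
  · rw [Set.indicator_of_notMem hω, h2 hω]

theorem bandProj_add_bandProj (X : KotheSpace 𝕜 μ) {A B : Set Ω} (hA : MeasurableSet A)
    (hB : MeasurableSet B) (hAB : IsCompl A B) (f : X.Elem) :
    (X.bandProj hA f : X.Elem) + X.bandProj hB f = f := by
  refine X.toFn_injective (AEEqFun.ext ?_)
  rw [map_add, toFn_bandProj, toFn_bandProj]
  filter_upwards [coeFn_charFn_mul hA (X.toFn f), coeFn_charFn_mul hB (X.toFn f),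
    AEEqFun.coeFn_add (charFn 𝕜 μ hA * X.toFn f) (charFn 𝕜 μ hB * X.toFn f)] with ω h1 h2 h3
  rw [h3, Pi.add_apply, h1, h2, ← hAB.compl_eq]
  exact congrFun (Set.indicator_self_add_compl A (X.toFn f)) ω

end Projection

/-! ### Block decomposition of the multiplication operator -/

section Multiplication

variable {Ω : Type*} [MeasurableSpace Ω] {𝕜 : Type*} [RCLike 𝕜] {μ : Measure Ω}
  (X Y : KotheSpace 𝕜 μ) (l : Ω →ₘ[μ] 𝕜) (hl : l ∈ multipliers X Y)

/-- The product of `l` with a function supported in A is again supported in A, so the final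
projection acts as the identity. -/
theorem mulOpRestrict_eq_comp {A : Set Ω} (hA : MeasurableSet A) :
    mulOpRestrict X Y l hl A
      = (Y.bandProj hA).comp ((mulOp X Y l hl).comp (X.restrict A).subtypeL) := by
  ext1 f
  exact (Y.bandProj_restrict hA (mulOpRestrict X Y l hl A f)).symm

theorem mulOp_eq_add {A B : Set Ω} (hA : MeasurableSet A) (hB : MeasurableSet B)
    (hAB : IsCompl A B) :
    mulOp X Y l hl
      = (Y.restrict A).subtypeL.comp ((mulOpRestrict X Y l hl A).comp (X.bandProj hA))
        + (Y.restrict B).subtypeL.comp ((mulOpRestrict X Y l hl B).comp (X.bandProj hB)) := by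
  ext1 f
  -- Followed by the inclusion into `Y`, each block is `mulOp` itself by definition; linearity then
  -- reduces the claim to f = f χ_A + f χ_B.
  change _ = mulOp X Y l hl (X.bandProj hA f : X.Elem) + mulOp X Y l hl (X.bandProj hB f : X.Elem)
  rw [← map_add, X.bandProj_add_bandProj hA hB hAB]

theorem essNorm_mulOpRestrict_le {A : Set Ω} (hA : MeasurableSet A) :
    essNorm (mulOpRestrict X Y l hl A) ≤ essNorm (mulOp X Y l hl) := by
  rw [mulOpRestrict_eq_comp X Y l hl hA]
  exact essNorm_comp_comp_le _ _ _ (Submodule.norm_subtypeL_le _) (Y.norm_bandProj_le hA)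

theorem essNorm_mulOp_le_add {A B : Set Ω} (hA : MeasurableSet A) (hB : MeasurableSet B)
    (hAB : IsCompl A B) :
    essNorm (mulOp X Y l hl)
      ≤ essNorm (mulOpRestrict X Y l hl A) + essNorm (mulOpRestrict X Y l hl B) := by
  rw [mulOp_eq_add X Y l hl hA hB hAB]
  exact (essNorm_add_le _ _).trans (add_le_add
    (essNorm_comp_comp_le _ _ _ (X.norm_bandProj_le hA) (Submodule.norm_subtypeL_le _))
    (essNorm_comp_comp_le _ _ _ (X.norm_bandProj_le hB) (Submodule.norm_subtypeL_le _)))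

end Multiplication

end KotheSpace

theorem mainTheorem3 {Ω : Type*} [MeasurableSpace Ω] (μ : Measure Ω) [SigmaFinite μ]
    [μ.IsComplete] {𝕜 : Type*} [RCLike 𝕜] (X Y : KotheSpace 𝕜 μ)
    (hX : X.FatouProperty) (hY : Y.FatouProperty)
    (hXY : IsReflexiveSpace 𝕜 X.Elem ∨ IsReflexiveSpace 𝕜 Y.Elem)
    (Ωc Ωa : Set Ω) (hΩ : IsAtomicDecomposition μ Ωc Ωa)
    (l : Ω →ₘ[μ] 𝕜) (hl : l ∈ KotheSpace.multipliers X Y) :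
    max (essNorm (KotheSpace.mulOpRestrict X Y l hl Ωc))
        (essNorm (KotheSpace.mulOpRestrict X Y l hl Ωa))
      ≤ essNorm (KotheSpace.mulOp X Y l hl) ∧
    essNorm (KotheSpace.mulOp X Y l hl)
      ≤ 2 * max (essNorm (KotheSpace.mulOpRestrict X Y l hl Ωc))
          (essNorm (KotheSpace.mulOpRestrict X Y l hl Ωa)) := by
  have hc := hΩ.measurableSet_c
  have ha := hΩ.measurableSet_a
  refine ⟨max_le (KotheSpace.essNorm_mulOpRestrict_le X Y l hl hc)
    (KotheSpace.essNorm_mulOpRestrict_le X Y l hl ha), ?_⟩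
  -- Each of the two summands is bounded by the maximum.
  rw [two_mul]
  exact (KotheSpace.essNorm_mulOp_le_add X Y l hl hc ha hΩ.isCompl).trans
    (add_le_add (le_max_left _ _) (le_max_right _ _))
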